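/- For a finite simple graph $G$, a set $D\subseteq V(G)$ is dominating if every vertex outside $D$ is adjacent to a vertex of $D$, and $\gamma(G)$ is the minimum cardinality of a dominating set. For a function $f:V(G)\to V(G)$, the functigraph $C(G,f)$ is the graph formed by two disjoint copies $G_1,G_2$ of $G$ together with the edges joining each vertex $u$ of $G_1$ to the copy of $f(u)$ in $G_2$. Let $C_{3k}$ be the cycle with vertices labeled cyclically $1,2,\dots,3k$. A function $f:\{1,\dots,3k\}\to\{1,\dots,3k\}$ is a three-translate if $f(x+3i)=f(x)+3i$ for all $x\in\{1,2,3\}$ and $i\in\{0,1,\dots,k-1\}$, where the addition is that of integers; such an $f$ maps $\{1,2,3\}$ into itself and is determined by $\tilde f=f|_{\{1,2,3\}}$. For $a_1,a_2,a_3\in\{1,2,3\}$ write $C(C_{3k},(a_1,a_2,a_3))$ for $C(C_{3k},g)$, where $g$ is the three-translate with $g(1)=a_1$, $g(2)=a_2$, $g(3)=a_3$. Theorem. Let $k\ge 3$ and let $f:\{1,\dots,3k\}\to\{1,\dots,3k\}$ be a three-translate which is not a permutation. Then $2\gamma(C_{3k})=2k$, and $\gamma(C(C_{3k},f))=2k$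 if and only if $C(C_{3k},f)$ is isomorphic (as a graph) to $C(C_{3k},(1,1,2))$, to $C(C_{3k},(1,2,1))$, or to $C(C_{3k},(1,3,1))$. -/

import Mathlib

namespace Functigraph

/-- `D` is a dominating set of `G`: every vertex outside `D` is adjacent to some vertex of `D`. -/
def IsDominatingSet {V : Type*} (G : SimpleGraph V) (D : Finset V) : Prop :=
  ∀ v : V, v ∉ D → ∃ u ∈ D, G.Adj u v

/-- The domination number of a finite graph: the minimum cardinality of a dominating set.
(The vertex set is itself dominating, so the set of which the infimum is taken is nonempty.) -/
noncomputable def dominationNumber {V : Type*} [Fintype V] (G : SimpleGraph V) : ℕ :=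
  sInf {m : ℕ | ∃ D : Finset V, IsDominatingSet G D ∧ D.card = m}

/-- The functigraph `C(G, f)`: two disjoint copies of `G` (the domain copy `Sum.inl` and the
codomain copy `Sum.inr`) together with the edges `{u, f u}`, `u` in the domain copy. -/
def functigraph {V : Type*} (G : SimpleGraph V) (f : V → V) : SimpleGraph (V ⊕ V) where
  Adj a b := match a, b with
    | Sum.inl u, Sum.inl v => G.Adj u v
    | Sum.inr u, Sum.inr v => G.Adj u v
    | Sum.inl u, Sum.inr v => v = f u
    | Sum.inr v, Sum.inl u => v = f u
  symm := ⟨by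
    rintro (u | u) (v | v) h
    · exact SimpleGraph.Adj.symm h
    · exact h
    · exact h
    · exact SimpleGraph.Adj.symm h⟩
  loopless := ⟨by
    rintro (u | u) h
    · exact G.loopless.irrefl u h
    · exact G.loopless.irrefl u h⟩

/-- `f` is a three-translate of `{1, …, 3k}`: `f (x + 3i) = f x + 3i` as integers, for
`x ∈ {1, 2, 3}` and `0 ≤ i < k`. The element `j` of `{1, …, 3k}` is the index `j - 1` of
`Fin (3 * k)`, so that `x` and `y = x + 3i` below run through the indices. -/
def IsThreeTranslate (k : ℕ) (f : Fin (3 * k) → Fin (3 * k)) : Prop :=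
  ∀ (x y : Fin (3 * k)) (i : ℕ), (x : ℕ) < 3 → i < k → (y : ℕ) = x + 3 * i →
    (f y : ℕ) = f x + 3 * i

/-- The three-translate of `{1, …, 3k}` with given restriction to `{1, 2, 3}`, in indices starting
from `0`: it maps `r + 3i` to `a r + 3i` for `r = 0, 1, 2` and `0 ≤ i < k`. Thus the three-translate
whose restriction to `{1, 2, 3}` is `(a₁, a₂, a₃)` is `threeTranslate k ![a₁ - 1, a₂ - 1, a₃ - 1]`;
for instance `(1, 1, 2)`, `(1, 2, 1)` and `(1, 3, 1)` are given by `![0, 0, 1]`, `![0, 1, 0]` and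
`![0, 2, 0]`. -/
def threeTranslate (k : ℕ) (a : Fin 3 → Fin 3) (x : Fin (3 * k)) : Fin (3 * k) :=
  ⟨(a ⟨(x : ℕ) % 3, Nat.mod_lt _ (by norm_num)⟩ : ℕ) + 3 * ((x : ℕ) / 3), by omega⟩

end Functigraph

/-!
Two copies of a dominating set of `G` dominate `C(G, f)`, so that `γ(C(C_{3k}, f)) ≤ 2k`. Rotating
the two copies of the cycle independently and reversing both reduces a three-translate that is not
a permutation to one of `(1,1,2)`, `(1,2,1)`, `(1,3,1)`, `(1,1,1)`, `(2,1,1)`, `(3,1,1)`.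

Cut the cycle into `k` blocks of three labels. Whether a vertex of a block is dominated depends only
on the chosen vertices in that block and in the two adjacent ones, and a dominating set amounts to a
closed walk of length `k` through parts of a block of six vertices, any two consecutive parts being
compatible. For the last three maps there is a loop at a part of two vertices, with a detour through
two parts of only three vertices in total; so `2k - 1` vertices suffice. For the first three maps a
potential on the parts shows that the parts on a closed walk have at least two vertices on average.
-/

namespace Functigraph

open Finset SimpleGraph Sum

section Domination

variable {V W : Type*} {G : SimpleGraph V} {H : SimpleGraph W} {D : Finset V}

theorem IsDominatingSet.map (e : G ≃g H) (hD : IsDominatingSet G D) :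
    IsDominatingSet H (D.map e.toEquiv.toEmbedding) := by
  intro w hw
  obtain ⟨v, rfl⟩ := e.surjective w
  obtain ⟨u, hu, huv⟩ := hD v fun hv => hw (mem_map.2 ⟨v, hv, rfl⟩)
  exact ⟨e u, mem_map.2 ⟨u, hu, rfl⟩, e.map_adj_iff.2 huv⟩

variable [Fintype V] [Fintype W]

theorem IsDominatingSet.card_le_card_mul_succ [DecidableRel G.Adj] {d : ℕ}
    (hD : IsDominatingSet G D) (hd : ∀ v, G.degree v ≤ d) :
    Fintype.card V ≤ #D * (d + 1) := by
  classical
  have hcover : univ = D.biUnion fun u => insert u (G.neighborFinset u) := by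
    ext v
    by_cases hv : v ∈ D
    · simpa using ⟨v, hv, Or.inl rfl⟩
    · obtain ⟨u, hu, huv⟩ := hD v hv
      simpa using ⟨u, hu, Or.inr huv⟩
  rw [← card_univ, hcover]
  refine card_biUnion_le_card_mul D _ _ fun u _ => (card_insert_le _ _).trans ?_
  exact Nat.succ_le_succ (hd u)

theorem IsDominatingSet.dominationNumber_le (hD : IsDominatingSet G D) :
    dominationNumber G ≤ #D :=
  Nat.sInf_le ⟨D, hD, rfl⟩

variable (G) in
theorem exists_isDominatingSet_card_eq : ∃ D, IsDominatingSet G D ∧ #D = dominationNumber G :=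
  Nat.sInf_mem (s := {m | ∃ D, IsDominatingSet G D ∧ #D = m})
    ⟨_, univ, fun v hv => absurd (mem_univ v) hv, rfl⟩

theorem dominationNumber_le_of_iso (e : G ≃g H) : dominationNumber H ≤ dominationNumber G := by
  obtain ⟨D, hD, hcard⟩ := exists_isDominatingSet_card_eq G
  simpa [hcard] using (hD.map e).dominationNumber_le

theorem dominationNumber_congr (e : G ≃g H) : dominationNumber G = dominationNumber H :=
  (dominationNumber_le_of_iso e.symm).antisymm (dominationNumber_le_of_iso e)

end Domination

section General

variable {V : Type*} {G : SimpleGraph V} {f g : V → V}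

/-- Automorphisms `σ`, `τ` of `G` with `τ ∘ f = g ∘ σ`, applied to the domain copy and to the
codomain copy respectively, form an isomorphism from `C(G, f)` to `C(G, g)`. -/
def functigraphIso (σ τ : G ≃g G) (h : ∀ x, τ (f x) = g (σ x)) :
    functigraph G f ≃g functigraph G g where
  toEquiv := Equiv.sumCongr σ.toEquiv τ.toEquiv
  map_rel_iff' := by
    rintro (u | u) (v | v)
    · exact σ.map_adj_iff
    · change τ v = g (σ u) ↔ v = f u
      rw [← h, τ.injective.eq_iff]
    · change τ u = g (σ v) ↔ u = f v
      rw [← h, τ.injective.eq_iff]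
    · exact τ.map_adj_iff

theorem isDominatingSet_functigraph_iff {D : Finset (V ⊕ V)} :
    IsDominatingSet (functigraph G f) D ↔
      (∀ v, inl v ∈ D ∨ inr (f v) ∈ D ∨ ∃ u, G.Adj u v ∧ inl u ∈ D) ∧
      ∀ v, inr v ∈ D ∨ (∃ u, f u = v ∧ inl u ∈ D) ∨ ∃ u, G.Adj u v ∧ inr u ∈ D := by
  simp only [IsDominatingSet, Sum.forall, Sum.exists, functigraph, exists_eq_right,
    or_iff_not_imp_left]
  grind

theorem dominationNumber_functigraph_le [Fintype V] :
    dominationNumber (functigraph G f) ≤ 2 * dominationNumber G := by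
  obtain ⟨D, hD, hcard⟩ := exists_isDominatingSet_card_eq G
  have hDD : IsDominatingSet (functigraph G f) (D.disjSum D) := by
    rw [isDominatingSet_functigraph_iff]
    simp only [inl_mem_disjSum, inr_mem_disjSum]
    grind [IsDominatingSet]
  calc dominationNumber (functigraph G f) ≤ #(D.disjSum D) := hDD.dominationNumber_le
    _ = 2 * dominationNumber G := by rw [card_disjSum, hcard, two_mul]

end General

section Cycle

variable {n : ℕ} [NeZero n]

theorem cycleGraph_adj_iff (hn : 2 ≤ n) {u v : Fin n} :
    (cycleGraph n).Adj u v ↔ u = v - 1 ∨ u = v + 1 := by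
  obtain ⟨m, rfl⟩ := Nat.exists_eq_add_of_le' hn
  rw [cycleGraph_adj, sub_eq_iff_eq_add', sub_eq_iff_eq_add, eq_sub_iff_add_eq']
  grind

/-- The rotation of a cycle by `d`. -/
def cycleRotation (hn : 2 ≤ n) (d : Fin n) : cycleGraph n ≃g cycleGraph n where
  toEquiv := Equiv.addRight d
  map_rel_iff' {u v} := by
    simp only [Equiv.coe_addRight, cycleGraph_adj_iff hn, add_right_comm v d 1,
      add_sub_right_comm v d 1, add_left_inj]

/-- The reflection of a cycle reversing the order of the labels. -/
def cycleReversal (hn : 2 ≤ n) : cycleGraph n ≃g cycleGraph n where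
  toEquiv := Fin.revPerm
  map_rel_iff' {u v} := by
    rw [cycleGraph_adj_iff hn, cycleGraph_adj_iff hn, Fin.revPerm_apply, Fin.revPerm_apply,
      ← Fin.rev_sub, ← Fin.rev_add, Fin.rev_inj, Fin.rev_inj, or_comm]

omit [NeZero n] in
theorem degree_cycleGraph_le_two (v : Fin n) : (cycleGraph n).degree v ≤ 2 := by
  rcases n with _ | _ | _ | n
  · exact v.elim0
  · revert v; decide
  · revert v; decide
  · exact cycleGraph_degree_three_le.le

end Cycle

section ThreeTranslate

variable {k : ℕ}

/-- The map `r + 3i ↦ a r + 3i` on all of `ℕ`, whose reduction modulo `3k` is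
`threeTranslate k a`. -/
def natThreeTranslate (a : Fin 3 → Fin 3) (n : ℕ) : ℕ :=
  a (Fin.ofNat 3 n) + 3 * (n / 3)

theorem val_threeTranslate (a : Fin 3 → Fin 3) (x : Fin (3 * k)) :
    (threeTranslate k a x : ℕ) = natThreeTranslate a x :=
  rfl

theorem natThreeTranslate_add_three_mul (a : Fin 3 → Fin 3) (m n : ℕ) :
    natThreeTranslate a (m + 3 * n) = natThreeTranslate a m + 3 * n := by
  have hmod : Fin.ofNat 3 (m + 3 * n) = Fin.ofNat 3 m := Fin.ext (by simp)
  rw [natThreeTranslate, natThreeTranslate, hmod]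
  omega

theorem natThreeTranslate_mod [NeZero k] (a : Fin 3 → Fin 3) (n : ℕ) :
    natThreeTranslate a (n % (3 * k)) = natThreeTranslate a n % (3 * k) := by
  have hlt : n % (3 * k) < 3 * k := Nat.mod_lt _ (NeZero.pos _)
  conv_rhs => rw [← Nat.mod_add_div n (3 * k), mul_assoc, natThreeTranslate_add_three_mul,
    ← mul_assoc, Nat.add_mul_mod_self_left]
  refine (Nat.mod_eq_of_lt ?_).symm
  unfold natThreeTranslate
  omega

theorem threeTranslate_injective {a : Fin 3 → Fin 3} (ha : Function.Injective a) :
    Function.Injective (threeTranslate k a) := by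
  intro x y hxy
  have hval : natThreeTranslate a x = natThreeTranslate a y := congrArg Fin.val hxy
  unfold natThreeTranslate at hval
  have hres : Fin.ofNat 3 x = Fin.ofNat 3 y := ha (Fin.ext (by omega))
  have hmod : (x : ℕ) % 3 = y % 3 := congrArg Fin.val hres
  exact Fin.ext (by omega)

theorem IsThreeTranslate.exists_eq_threeTranslate [NeZero k] {f : Fin (3 * k) → Fin (3 * k)}
    (hf : IsThreeTranslate k f) : ∃ a, f = threeTranslate k a := by
  have hk := NeZero.pos k
  -- The last block of three labels is mapped below `3k`, so the first one is mapped below `3`.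
  have hlt (r : Fin 3) : (f ⟨r, by omega⟩ : ℕ) < 3 := by
    have hlast := hf ⟨r, by omega⟩ ⟨r + 3 * (k - 1), by omega⟩ (k - 1) r.isLt (by omega) rfl
    omega
  refine ⟨fun r => ⟨f ⟨r, by omega⟩, hlt r⟩, funext fun y => Fin.ext ?_⟩
  exact hf ⟨y % 3, by omega⟩ y (y / 3) (Nat.mod_lt _ (by norm_num)) (by omega)
    (Nat.mod_add_div _ _).symm

theorem rev_threeTranslate_rev (a : Fin 3 → Fin 3) (x : Fin (3 * k)) :
    (threeTranslate k a x.rev).rev = threeTranslate k (Fin.rev ∘ a ∘ Fin.rev) x := by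
  have hres : Fin.ofNat 3 (3 * k - (x + 1)) = (Fin.ofNat 3 x).rev :=
    Fin.ext (by simp only [Fin.val_ofNat, Fin.val_rev]; omega)
  apply Fin.ext
  simp only [val_threeTranslate, natThreeTranslate, Fin.val_rev, Function.comp_apply, hres]
  omega

/-- The functigraph `C(C_{3k}, (a 0 + 1, a 1 + 1, a 2 + 1))`. -/
abbrev translateGraph (k : ℕ) (a : Fin 3 → Fin 3) : SimpleGraph (Fin (3 * k) ⊕ Fin (3 * k)) :=
  functigraph (cycleGraph (3 * k)) (threeTranslate k a)

/-- The three-translate given by `b` arises from the one given by `a` by rotating the domain copy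
by `s` and the codomain copy by `t`. This is stated for one period of the maps on `ℕ`, which makes
it decidable and independent of `k`. -/
def IsRotation (a b : Fin 3 → Fin 3) : Prop :=
  ∃ s t : Fin 3, ∀ r : Fin 3, natThreeTranslate b (r + s) = a r + t

instance (a b : Fin 3 → Fin 3) : Decidable (IsRotation a b) := by
  unfold IsRotation
  infer_instance

variable [NeZero k]

theorem IsRotation.nonempty_iso {a b : Fin 3 → Fin 3} (h : IsRotation a b) :
    Nonempty (translateGraph k a ≃g translateGraph k b) := by
  obtain ⟨s, t, hst⟩ := h
  have hn : 2 ≤ 3 * k := by have := NeZero.pos k; omega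
  have hnat (n : ℕ) : natThreeTranslate b (n + s) = natThreeTranslate a n + t := by
    have hr := hst (Fin.ofNat 3 n)
    calc natThreeTranslate b (n + s) = natThreeTranslate b (n % 3 + s + 3 * (n / 3)) := by
          congr 1; omega
      _ = natThreeTranslate a n + t := by
          rw [natThreeTranslate_add_three_mul, ← Fin.val_ofNat, hr, natThreeTranslate]
          omega
  refine ⟨functigraphIso (cycleRotation hn (Fin.ofNat _ s)) (cycleRotation hn (Fin.ofNat _ t))
    fun x => Fin.ext ?_⟩
  change (threeTranslate k a x + Fin.ofNat (3 * k) t : Fin (3 * k)).val =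
    threeTranslate k b (x + Fin.ofNat (3 * k) s)
  simp only [Fin.val_add, Fin.val_ofNat, val_threeTranslate, natThreeTranslate_mod,
    Nat.add_mod_mod, hnat]

variable (k) in
theorem nonempty_iso_translateGraph_rev (a : Fin 3 → Fin 3) :
    Nonempty (translateGraph k a ≃g translateGraph k (Fin.rev ∘ a ∘ Fin.rev)) := by
  have hn : 2 ≤ 3 * k := by have := NeZero.pos k; omega
  refine ⟨functigraphIso (cycleReversal hn) (cycleReversal hn) fun x => ?_⟩
  change (threeTranslate k a x).rev = threeTranslate k (Fin.rev ∘ a ∘ Fin.rev) x.rev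
  rw [← rev_threeTranslate_rev, Fin.rev_rev]

/-- Representatives of the non-injective maps `Fin 3 → Fin 3` up to independent rotations of the
two copies of the cycle and reversal of both. -/
def representatives : Finset (Fin 3 → Fin 3) :=
  {![0, 0, 1], ![0, 1, 0], ![0, 2, 0], ![0, 0, 0], ![1, 0, 0], ![2, 0, 0]}

theorem exists_isRotation_of_not_injective {a : Fin 3 → Fin 3} (ha : ¬ Function.Injective a) :
    ∃ c ∈ representatives, IsRotation c a ∨ IsRotation c (Fin.rev ∘ a ∘ Fin.rev) := by
  revert a
  decide +kernel

variable (k) in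
theorem exists_iso_of_not_injective {a : Fin 3 → Fin 3} (ha : ¬ Function.Injective a) :
    ∃ c ∈ representatives, Nonempty (translateGraph k a ≃g translateGraph k c) := by
  obtain ⟨c, hc, h | h⟩ := exists_isRotation_of_not_injective ha
  · obtain ⟨e⟩ := h.nonempty_iso (k := k)
    exact ⟨c, hc, ⟨e.symm⟩⟩
  · obtain ⟨e⟩ := h.nonempty_iso (k := k)
    obtain ⟨e'⟩ := nonempty_iso_translateGraph_rev k a
    exact ⟨c, hc, ⟨e'.trans e.symm⟩⟩

end ThreeTranslate

section Blocks

variable {k : ℕ} {a : Fin 3 → Fin 3}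

/-- The vertices of `C_{3k}` in `k` consecutive blocks of three: `vertex (q, r)` is the vertex with
index `r + 3q`. -/
def vertex : Fin k × Fin 3 ≃ Fin (3 * k) :=
  finProdFinEquiv.trans (finCongr (Nat.mul_comm k 3))

theorem val_vertex (q : Fin k) (r : Fin 3) : (vertex (q, r) : ℕ) = r + 3 * q :=
  rfl

theorem threeTranslate_vertex (q : Fin k) (r : Fin 3) :
    threeTranslate k a (vertex (q, r)) = vertex (q, a r) := by
  apply Fin.ext
  have hres : Fin.ofNat 3 r = r := Fin.ext (Nat.mod_eq_of_lt r.isLt)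
  rw [val_threeTranslate, val_vertex, val_vertex, natThreeTranslate_add_three_mul,
    natThreeTranslate, hres, Nat.div_eq_of_lt r.isLt, Nat.mul_zero, Nat.add_zero]

theorem exists_threeTranslate_eq_vertex_iff {P : Fin (3 * k) → Prop} {q : Fin k} {j : Fin 3} :
    (∃ x, threeTranslate k a x = vertex (q, j) ∧ P x) ↔ ∃ r, a r = j ∧ P (vertex (q, r)) := by
  simp only [← vertex.exists_congr_right, Prod.exists, threeTranslate_vertex,
    EmbeddingLike.apply_eq_iff_eq, Prod.mk.injEq, and_assoc]
  grind

/-- A part of a block: a set of vertices from the six vertices of the two copies of a block of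
`C_{3k}`, where `inl r` and `inr r` are the `r`-th vertices in the domain and in the codomain. -/
abbrev BlockSet : Type := Finset (Fin 3 ⊕ Fin 3)

/-- The last domain vertex of a block is dominated by the part `b` of that block. -/
def LastDomainDominated (a : Fin 3 → Fin 3) (b : BlockSet) : Prop :=
  inl 2 ∈ b ∨ inr (a 2) ∈ b ∨ inl 1 ∈ b

/-- The last codomain vertex of a block is dominated by the part `b` of that block. -/
def LastCodomainDominated (a : Fin 3 → Fin 3) (b : BlockSet) : Prop :=
  inr 2 ∈ b ∨ (∃ r, a r = 2 ∧ inl r ∈ b) ∨ inr 1 ∈ b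

/-- The parts `u` and `b` of two consecutive blocks dominate, in both copies, the last vertex of the
first block and the first two vertices of the second one. All neighbours of these six vertices lie
in the two blocks, so that domination in a functigraph is a condition on consecutive blocks. -/
def Compatible (a : Fin 3 → Fin 3) (u b : BlockSet) : Prop :=
  (LastDomainDominated a u ∨ inl 0 ∈ b) ∧
  (inl 0 ∈ b ∨ inr (a 0) ∈ b ∨ inl 2 ∈ u ∨ inl 1 ∈ b) ∧
  (inl 1 ∈ b ∨ inr (a 1) ∈ b ∨ inl 0 ∈ b ∨ inl 2 ∈ b) ∧
  (LastCodomainDominated a u ∨ inr 0 ∈ b) ∧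
  (inr 0 ∈ b ∨ (∃ r, a r = 0 ∧ inl r ∈ b) ∨ inr 2 ∈ u ∨ inr 1 ∈ b) ∧
  (inr 1 ∈ b ∨ (∃ r, a r = 1 ∧ inl r ∈ b) ∨ inr 0 ∈ b ∨ inr 2 ∈ b)

instance (b : BlockSet) : Decidable (LastDomainDominated a b) := by
  unfold LastDomainDominated
  infer_instance

instance (b : BlockSet) : Decidable (LastCodomainDominated a b) := by
  unfold LastCodomainDominated
  infer_instance

instance (u b : BlockSet) : Decidable (Compatible a u b) := by
  unfold Compatible
  infer_instance

/-- The bijection from the vertices of the blocks to those of a functigraph of `C_{3k}`. -/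
def blockVertex : Fin k × (Fin 3 ⊕ Fin 3) ≃ Fin (3 * k) ⊕ Fin (3 * k) :=
  (Equiv.prodSumDistrib _ _ _).trans (vertex.sumCongr vertex)

theorem blockVertex_inl (q : Fin k) (r : Fin 3) :
    blockVertex (q, inl r) = inl (vertex (q, r)) :=
  rfl

theorem blockVertex_inr (q : Fin k) (r : Fin 3) :
    blockVertex (q, inr r) = inr (vertex (q, r)) :=
  rfl

/-- The part of the vertex set `D` lying in the block `q`. -/
def blockPart (D : Finset (Fin (3 * k) ⊕ Fin (3 * k))) (q : Fin k) : BlockSet :=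
  univ.filter fun s => blockVertex (q, s) ∈ D

theorem mem_blockPart {D : Finset (Fin (3 * k) ⊕ Fin (3 * k))} {q : Fin k} {s : Fin 3 ⊕ Fin 3} :
    s ∈ blockPart D q ↔ blockVertex (q, s) ∈ D := by
  simp [blockPart]

theorem exists_blockPart_eq (c : Fin k → BlockSet) : ∃ D, blockPart D = c := by
  refine ⟨univ.filter fun v => (blockVertex.symm v).2 ∈ c (blockVertex.symm v).1, ?_⟩
  ext q s
  simp [mem_blockPart]

theorem sum_card_blockPart (D : Finset (Fin (3 * k) ⊕ Fin (3 * k))) :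
    ∑ q, #(blockPart D q) = #D := by
  simp only [blockPart, card_filter]
  rw [← Fintype.sum_prod_type', blockVertex.sum_comp fun v => if v ∈ D then 1 else 0]
  simp

variable [NeZero k]

theorem val_vertex_add_one (q : Fin k) (r : Fin 3) :
    (vertex (q, r) + 1 : Fin (3 * k)).val = (r + 3 * q + 1) % (3 * k) := by
  rw [Fin.val_add, Fin.val_one', Nat.add_mod_mod, val_vertex]

theorem vertex_zero_add_one (q : Fin k) : vertex (q, 0) + 1 = vertex (q, 1) := by
  apply Fin.ext
  rw [val_vertex_add_one, val_vertex, Nat.mod_eq_of_lt (by lia)]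
  lia

theorem vertex_one_add_one (q : Fin k) : vertex (q, 1) + 1 = vertex (q, 2) := by
  apply Fin.ext
  rw [val_vertex_add_one, val_vertex, Nat.mod_eq_of_lt (by lia)]
  lia

theorem vertex_two_add_one (q : Fin k) : vertex (q, 2) + 1 = vertex (q + 1, 0) := by
  apply Fin.ext
  have hval : (2 : Fin 3).val + 3 * q + 1 = 3 * (q + 1) := by lia
  rw [val_vertex_add_one, val_vertex, hval, Nat.mul_mod_mul_left, Fin.val_add, Fin.val_one',
    Nat.add_mod_mod]
  simp

theorem forall_iff_forall_vertex {P : Fin (3 * k) → Prop} :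
    (∀ v, P v) ↔
      ∀ q, P (vertex (q, 2)) ∧ P (vertex (q + 1, 0)) ∧ P (vertex (q + 1, 1)) := by
  have hshift (r : Fin 3) : (∀ q, P (vertex (q + 1, r))) ↔ ∀ q, P (vertex (q, r)) :=
    (Equiv.addRight (1 : Fin k)).forall_congr_right (q := fun q => P (vertex (q, r)))
  simp only [← vertex.forall_congr_right, Prod.forall, forall_and, hshift, Fin.forall_fin_succ]
  grind

theorem isDominatingSet_iff_compatible {D : Finset (Fin (3 * k) ⊕ Fin (3 * k))} :
    IsDominatingSet (translateGraph k a) D ↔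
      ∀ q, Compatible a (blockPart D q) (blockPart D (q + 1)) := by
  have hn : 2 ≤ 3 * k := by have := NeZero.pos k; omega
  have hsub1 (q : Fin k) : vertex (q, 1) - 1 = vertex (q, 0) :=
    sub_eq_of_eq_add (vertex_zero_add_one q).symm
  have hsub2 (q : Fin k) : vertex (q, 2) - 1 = vertex (q, 1) :=
    sub_eq_of_eq_add (vertex_one_add_one q).symm
  have hsub0 (q : Fin k) : vertex (q + 1, 0) - 1 = vertex (q, 2) :=
    sub_eq_of_eq_add (vertex_two_add_one q).symm
  rw [isDominatingSet_functigraph_iff, forall_iff_forall_vertex, forall_iff_forall_vertex,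
    ← forall_and]
  simp only [cycleGraph_adj_iff hn, exists_eq_or_imp, exists_eq_left,
    exists_threeTranslate_eq_vertex_iff, threeTranslate_vertex, vertex_zero_add_one,
    vertex_one_add_one, vertex_two_add_one, hsub0, hsub1, hsub2, Compatible, LastDomainDominated,
    LastCodomainDominated, mem_blockPart, blockVertex_inl, blockVertex_inr, and_assoc, or_assoc]

theorem dominationNumber_cycleGraph_three_mul : dominationNumber (cycleGraph (3 * k)) = k := by
  have hn : 2 ≤ 3 * k := by have := NeZero.pos k; omega
  refine le_antisymm ?_ ?_
  · have hD : IsDominatingSet (cycleGraph (3 * k)) (univ.image fun q => vertex (q, 1)) := by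
      refine forall_iff_forall_vertex.2 fun q => ⟨fun _ => ?_, fun _ => ?_, fun h => ?_⟩
      · exact ⟨vertex (q, 1), by simp, by simp [cycleGraph_adj_iff hn, ← vertex_one_add_one]⟩
      · exact ⟨vertex (q + 1, 1), by simp, by simp [cycleGraph_adj_iff hn, ← vertex_zero_add_one]⟩
      · simp at h
    simpa using hD.dominationNumber_le.trans card_image_le
  · obtain ⟨D, hD, hcard⟩ := exists_isDominatingSet_card_eq (cycleGraph (3 * k))
    have hle := hD.card_le_card_mul_succ degree_cycleGraph_le_two
    rw [hcard, Fintype.card_fin] at hle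
    omega

theorem dominationNumber_lt_of_compatible (hk : 3 ≤ k) {s t p : BlockSet}
    (hst : Compatible a s t) (htp : Compatible a t p) (hpp : Compatible a p p)
    (hps : Compatible a p s) (hw : #s + #t < 4) (hp : #p ≤ 2) :
    dominationNumber (translateGraph k a) < 2 * k := by
  obtain ⟨m, rfl⟩ := Nat.exists_eq_add_of_le' hk
  obtain ⟨D, hD⟩ := exists_blockPart_eq (Fin.cons s (Fin.cons t fun _ : Fin (m + 1) => p))
  have hdom : IsDominatingSet (translateGraph (m + 3) a) D := by
    rw [isDominatingSet_iff_compatible, hD]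
    refine Fin.lastCases ?_ (Fin.cases ?_ (Fin.cases ?_ fun j => ?_))
    · rwa [Fin.last_add_one]
    · exact hst
    · exact htp
    · rwa [Fin.coeSucc_eq_succ]
  calc dominationNumber (translateGraph (m + 3) a) ≤ #D := hdom.dominationNumber_le
    _ = #s + (#t + (m + 1) * #p) := by
      simp [← sum_card_blockPart, hD, Fin.sum_univ_succ (n := m + 2),
        Fin.sum_univ_succ (n := m + 1)]
    _ < 2 * (m + 3) := by nlinarith

theorem card_mul_le_sum_of_potential {ι β : Type*} [Fintype ι] (σ : Equiv.Perm ι) {c : ι → β}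
    {w φ : β → ℕ} {m : ℕ} (h : ∀ i, m + φ (c (σ i)) ≤ w (c (σ i)) + φ (c i)) :
    Fintype.card ι * m ≤ ∑ i, w (c i) := by
  have hsum := sum_le_sum fun i (_ : i ∈ univ) => h i
  rw [sum_add_distrib, sum_add_distrib, Equiv.sum_comp σ fun i => φ (c i),
    Equiv.sum_comp σ fun i => w (c i), sum_const, card_univ, smul_eq_mul] at hsum
  exact Nat.le_of_add_le_add_right hsum

/- The potential `φ` telescopes along the closed walk formed by the block parts of a dominating
set. -/
theorem dominationNumber_eq_of_potential (φ : BlockSet → ℕ)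
    (hφ : ∀ u b, Compatible a u b → 2 + φ b ≤ #b + φ u) :
    dominationNumber (translateGraph k a) = 2 * k := by
  refine le_antisymm ?_ ?_
  · simpa [dominationNumber_cycleGraph_three_mul] using
      dominationNumber_functigraph_le (G := cycleGraph (3 * k)) (f := threeTranslate k a)
  · obtain ⟨D, hD, hcard⟩ := exists_isDominatingSet_card_eq (translateGraph k a)
    rw [isDominatingSet_iff_compatible] at hD
    have hsum := card_mul_le_sum_of_potential (Equiv.addRight 1) (w := card) fun q => hφ _ _ (hD q)
    rwa [sum_card_blockPart, hcard, Fintype.card_fin, mul_comm] at hsum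

theorem dominationNumber_translateGraph_000_lt (hk : 3 ≤ k) :
    dominationNumber (translateGraph k ![0, 0, 0]) < 2 * k :=
  dominationNumber_lt_of_compatible hk (s := {inr 0}) (t := {inr 0}) (p := {inr 0, inr 1})
    (by decide) (by decide) (by decide) (by decide) (by decide) (by decide)

theorem dominationNumber_translateGraph_100_lt (hk : 3 ≤ k) :
    dominationNumber (translateGraph k ![1, 0, 0]) < 2 * k :=
  dominationNumber_lt_of_compatible hk (s := {inr 0}) (t := {inr 0, inr 1}) (p := {inl 2, inr 1})
    (by decide) (by decide) (by decide) (by decide) (by decide) (by decide)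

theorem dominationNumber_translateGraph_200_lt (hk : 3 ≤ k) :
    dominationNumber (translateGraph k ![2, 0, 0]) < 2 * k :=
  dominationNumber_lt_of_compatible hk (s := {inl 2, inr 2}) (t := {inr 0}) (p := {inl 0, inr 0})
    (by decide) (by decide) (by decide) (by decide) (by decide) (by decide)

variable (k)

/- In the next three proofs, the potential of a block part measures what it contributes to the
domination of the next block; its defining inequality is checked on all pairs of block parts. -/
theorem dominationNumber_translateGraph_001 :
    dominationNumber (translateGraph k ![0, 0, 1]) = 2 * k :=
  dominationNumber_eq_of_potential
    (fun b => if inl 2 ∈ b ∧ inr 2 ∈ b then 2 else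
      if LastDomainDominated ![0, 0, 1] b ∨ LastCodomainDominated ![0, 0, 1] b then 1 else 0)
    (by decide +kernel)

theorem dominationNumber_translateGraph_010 :
    dominationNumber (translateGraph k ![0, 1, 0]) = 2 * k :=
  dominationNumber_eq_of_potential
    (fun b => if inl 2 ∈ b ∧ LastCodomainDominated ![0, 1, 0] b ∨
      LastDomainDominated ![0, 1, 0] b ∧ inr 2 ∈ b then 1 else 0)
    (by decide +kernel)

theorem dominationNumber_translateGraph_020 :
    dominationNumber (translateGraph k ![0, 2, 0]) = 2 * k :=
  dominationNumber_eq_of_potential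
    (fun b => if inl 2 ∈ b ∧ LastCodomainDominated ![0, 2, 0] b then 1 else 0)
    (by decide +kernel)

end Blocks

end Functigraph

theorem mainTheorem8 (k : ℕ) (hk : 3 ≤ k) (f : Fin (3 * k) → Fin (3 * k))
    (hf : Functigraph.IsThreeTranslate k f) (hnp : ¬ Function.Bijective f) :
    2 * Functigraph.dominationNumber (SimpleGraph.cycleGraph (3 * k)) = 2 * k ∧
    (Functigraph.dominationNumber
        (Functigraph.functigraph (SimpleGraph.cycleGraph (3 * k)) f) = 2 * k ↔
      (Nonempty (Functigraph.functigraph (SimpleGraph.cycleGraph (3 * k)) f ≃g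
          Functigraph.functigraph (SimpleGraph.cycleGraph (3 * k))
            (Functigraph.threeTranslate k ![0, 0, 1])) ∨
        Nonempty (Functigraph.functigraph (SimpleGraph.cycleGraph (3 * k)) f ≃g
          Functigraph.functigraph (SimpleGraph.cycleGraph (3 * k))
            (Functigraph.threeTranslate k ![0, 1, 0])) ∨
        Nonempty (Functigraph.functigraph (SimpleGraph.cycleGraph (3 * k)) f ≃g
          Functigraph.functigraph (SimpleGraph.cycleGraph (3 * k))
            (Functigraph.threeTranslate k ![0, 2, 0])))) := by
  have : NeZero k := ⟨by omega⟩
  refine ⟨by rw [Functigraph.dominationNumber_cycleGraph_three_mul], fun hγ => ?_, ?_⟩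
  · obtain ⟨a, rfl⟩ := hf.exists_eq_threeTranslate
    have ha : ¬ Function.Injective a := fun h =>
      hnp (Finite.injective_iff_bijective.1 (Functigraph.threeTranslate_injective h))
    obtain ⟨c, hc, ⟨e⟩⟩ := Functigraph.exists_iso_of_not_injective k ha
    rw [Functigraph.dominationNumber_congr e] at hγ
    simp only [Functigraph.representatives, Finset.mem_insert, Finset.mem_singleton] at hc
    rcases hc with rfl | rfl | rfl | rfl | rfl | rfl
    · exact Or.inl ⟨e⟩
    · exact Or.inr (Or.inl ⟨e⟩)
    · exact Or.inr (Or.inr ⟨e⟩)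
    · exact absurd hγ (Functigraph.dominationNumber_translateGraph_000_lt hk).ne
    · exact absurd hγ (Functigraph.dominationNumber_translateGraph_100_lt hk).ne
    · exact absurd hγ (Functigraph.dominationNumber_translateGraph_200_lt hk).ne
  · rintro (⟨⟨e⟩⟩ | ⟨⟨e⟩⟩ | ⟨⟨e⟩⟩)
    · exact (Functigraph.dominationNumber_congr e).trans
        (Functigraph.dominationNumber_translateGraph_001 k)
    · exact (Functigraph.dominationNumber_congr e).trans
        (Functigraph.dominationNumber_translateGraph_010 k)
    · exact (Functigraph.dominationNumber_congr e).trans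
        (Functigraph.dominationNumber_translateGraph_020 k)
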